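/- Let $\mathcal A$ be a $C^*$-algebra, $\mathcal B$ a $C^*$-subalgebra of $\mathcal A$, and $\mathcal E:\mathcal A\to\mathcal B$ a tracial conditional expectation, i.e. a contractive positive linear map with $\mathcal E(BAC)=B\,\mathcal E(A)\,C$ for all $A\in\mathcal A$, $B,C\in\mathcal B$ and $\mathcal E(XY)=\mathcal E(YX)$ for all $X,Y\in\mathcal A$. Let $\rho\in\mathcal A$ be positive, with spectrum $\sigma(\rho)$ (taken in $\mathcal A$ if $\mathcal A$ is unital and in the unitization of $\mathcal A$ otherwise; $f(\rho)$ and $g(\rho)$ are formed there as well). For continuous functions $f,g:\sigma(\rho)\to\mathbb R$ and $A,B\in\mathcal A$ put $$\mathrm{Corr}^{f,g}_{\rho,\mathcal E}(A,B)=\mathcal E\big(f(\rho)g(\rho)A^*B\big)-\mathcal E\big(f(\rho)A^*g(\rho)B\big),\qquad \mathrm I^{f,g}_{\rho,\mathcal E}(A)=\mathrm{Corr}^{f,g}_{\rho,\mathcal E}(A,A),$$ $$\mathrm{Corr}'^{\,f,g}_{\rho,\mathcal E}(A,B)=\tfrac12\Big(\mathrm{Corr}^{f,g}_{\rho,\mathcal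 E}(A,B)+\mathrm{Corr}^{f,g}_{\rho,\mathcal E}(B^*,A^*)\Big),$$ and write $|X|^2=X^*X$, $\mathrm{Re}\,X=\frac12(X+X^*)$. (1) If $(f(x)-f(y))(g(x)-g(y))\ge 0$ for all $x,y\in\sigma(\rho)$, then for all self-adjoint $A,B\in\mathcal A$ $$\big|\mathrm{Corr}'^{\,f,g}_{\rho,\mathcal E}(A,B)\big|^2=\big|\mathrm{Re}\,\mathrm{Corr}^{f,g}_{\rho,\mathcal E}(A,B)\big|^2\le \mathrm I^{f,g}_{\rho,\mathcal E}(A)\,\mathrm I^{f,g}_{\rho,\mathcal E}(B).$$ (2) If $f=g$, then for all normal $A,B\in\mathcal A$ $$\big|\mathrm{Corr}'^{\,f,f}_{\rho,\mathcal E}(A,B)\big|^2\le \mathrm I^{f,f}_{\rho,\mathcal E}(A)\,\mathrm I^{f,f}_{\rho,\mathcal E}(B).$$ -/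

import Mathlib

open scoped ComplexStarModule

noncomputable section

namespace SkewInformation

/-- `a` is invertible in `A`: the algebra `A` has a unit `e`, and `a` has an inverse `b`. -/
def IsInvertibleIn {A : Type*} [NonUnitalCStarAlgebra A] (a : A) : Prop :=
  ∃ e b : A, (∀ c : A, e * c = c ∧ c * e = c) ∧ a * b = e ∧ b * a = e

/-- The (real) spectrum of an element of a C*-algebra `A`: the spectrum in `A` if `A` is unital,
and the spectrum in the unitization of `A` otherwise. In both cases it arises from the
quasispectrum (which always contains `0`) by deleting `0` if the element is invertible in `A`. -/
def opSpectrum {A : Type*} [NonUnitalCStarAlgebra A] (a : A) : Set ℝ :=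
  {x : ℝ | x ∈ quasispectrum ℝ a ∧ (x = 0 → ¬ IsInvertibleIn a)}

/-- The product `f(ρ) a`, where `f(ρ)` is given by the continuous functional calculus. Since `A`
need not be unital, `f(ρ)` is formed in the unitization of `A`, of which `A` is an ideal. -/
def cfcMul {A : Type*} [NonUnitalCStarAlgebra A] (f : ℝ → ℝ) (ρ a : A) : A :=
  (cfc f (Unitization.inr ρ : Unitization ℂ A) * Unitization.inr a).snd

/-- `f` and `g` are same monotonic on `D`. -/
def SameMonotonicOn (f g : ℝ → ℝ) (D : Set ℝ) : Prop :=
  ∀ x ∈ D, ∀ y ∈ D, 0 ≤ (f x - f y) * (g x - g y)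

/-- The linear map `Φ` is tracial. -/
def IsTracial {A C : Type*} [NonUnitalCStarAlgebra A] [AddCommGroup C] [Module ℂ C]
    (Φ : A →ₗ[ℂ] C) : Prop :=
  ∀ a b : A, Φ (a * b) = Φ (b * a)

/-- `E` is a conditional expectation from `A` to the C*-subalgebra `B`: a contractive positive
linear map with values in `B` that is a `B`-bimodule map. -/
structure IsConditionalExpectation {A : Type*} [NonUnitalCStarAlgebra A] [PartialOrder A]
    (B : NonUnitalStarSubalgebra ℂ A) (E : A →ₗ[ℂ] A) : Prop where
  mem_range : ∀ a : A, E a ∈ B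
  contractive : ∀ a : A, ‖E a‖ ≤ ‖a‖
  positive : ∀ a : A, 0 ≤ a → 0 ≤ E a
  bimodule : ∀ a : A, ∀ b ∈ B, ∀ c ∈ B, E (b * a * c) = b * E a * c

/-- Generalized correlation `Φ(f(ρ) g(ρ) a* b) - Φ(f(ρ) a* g(ρ) b)`. -/
def corr {A C : Type*} [NonUnitalCStarAlgebra A] [AddCommGroup C] [Module ℂ C]
    (Φ : A →ₗ[ℂ] C) (f g : ℝ → ℝ) (ρ a b : A) : C :=
  Φ (cfcMul f ρ (cfcMul g ρ (star a * b))) - Φ (cfcMul f ρ (star a) * cfcMul g ρ b)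

/-- Generalized Wigner-Yanase-Dyson skew information. -/
def skewInfo {A C : Type*} [NonUnitalCStarAlgebra A] [AddCommGroup C] [Module ℂ C]
    (Φ : A →ₗ[ℂ] C) (f g : ℝ → ℝ) (ρ a : A) : C :=
  corr Φ f g ρ a a

/-- Generalized symmetric correlation. -/
def symmCorr {A C : Type*} [NonUnitalCStarAlgebra A] [AddCommGroup C] [Module ℂ C]
    (Φ : A →ₗ[ℂ] C) (f g : ℝ → ℝ) (ρ a b : A) : C :=
  (1 / 2 : ℂ) • (corr Φ f g ρ a b + corr Φ f g ρ (star b) (star a))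

/-- `|x|²`, where `|x| = (x* x)^(1/2)`. -/
def absSq {A : Type*} [NonUnitalCStarAlgebra A] [PartialOrder A] [StarOrderedRing A]
    (x : A) : A :=
  CFC.abs x * CFC.abs x

/-- `cfcMul f ρ a` is the product `f(ρ) a` in the unitization. -/
theorem inr_cfcMul {A : Type*} [NonUnitalCStarAlgebra A] (f : ℝ → ℝ) (ρ a : A) :
    Unitization.inr (cfcMul f ρ a) =
      cfc f (Unitization.inr ρ : Unitization ℂ A) * Unitization.inr a := by
  ext <;> simp [cfcMul]

/-- In a unital C*-algebra, `opSpectrum` is the usual spectrum. -/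
theorem opSpectrum_eq_spectrum {A : Type*} [CStarAlgebra A] (a : A) :
    opSpectrum a = spectrum ℝ a := by
  have h : IsInvertibleIn a ↔ IsUnit a := by
    constructor
    · rintro ⟨e, b, he, h1, h2⟩
      have : e = 1 := by simpa using (he 1).1
      subst this
      exact ⟨⟨a, b, h1, h2⟩, rfl⟩
    · rintro ⟨u, rfl⟩
      exact ⟨1, ↑u⁻¹, by simp⟩
  ext x
  simp only [opSpectrum, Set.mem_ofPred_eq, h, quasispectrum_eq_spectrum_union_zero]
  by_cases hx : x = 0
  · subst hx
    simp [spectrum.zero_mem_iff]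
  · simp [hx]

open scoped CStarAlgebra in
/-- In a unital C*-algebra, `cfcMul f ρ a` is the product of `cfc f ρ` and `a`. -/
theorem cfcMul_eq_cfc_mul {A : Type*} [CStarAlgebra A] (f : ℝ → ℝ) (ρ a : A)
    (hρ : IsSelfAdjoint ρ) (hf : ContinuousOn f (spectrum ℝ ρ)) :
    cfcMul f ρ a = cfc f ρ * a := by
  let φ : Unitization ℂ A →⋆ₐ[ℂ] A := Unitization.starLift (NonUnitalStarAlgHom.id ℂ A)
  have hφ : ∀ x : A, φ (Unitization.inr x) = x := fun x => by
    change Unitization.lift (NonUnitalStarAlgHom.id ℂ A).toNonUnitalAlgHom (Unitization.inr x) = x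
    simp
  have hf' : ContinuousOn f (spectrum ℝ (Unitization.inr ρ : Unitization ℂ A)) := by
    rw [← Unitization.quasispectrum_eq_spectrum_inr' ℝ ℂ, quasispectrum_eq_spectrum_union_zero]
    exact hf.union_of_isClosed (continuousOn_singleton f 0) (spectrum.isClosed ρ)
      isClosed_singleton
  have hc : Continuous φ := map_continuous φ
  have h1 := congrArg φ (inr_cfcMul f ρ a)
  rw [map_mul, hφ, hφ, StarAlgHom.map_cfc (p := IsSelfAdjoint) (q := IsSelfAdjoint) φ f
    (Unitization.inr ρ : Unitization ℂ A) hf' hc (hρ.inr ℂ) (by rw [hφ]; exact hρ), hφ] at h1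
  exact h1

end SkewInformation

end

open SkewInformation

/-!
The symmetrized correlation `S a b = symmCorr E f g ρ a b` is a sesquilinear form on all of `A`,
and the theorem is the Cauchy–Schwarz inequality for it. On self-adjoint elements `S` is the real
part of the correlation (`symmCorr_eq_realPart`), and `S a a` is the skew information if `a` is
self-adjoint, or if `a` is normal and `f = g` (`symmCorr_self_of_isSelfAdjoint`,
`symmCorr_self_of_isStarNormal`). So both parts follow from `absSq_symmCorr_le`, the second one
because every function is same monotonic with itself.

*Positivity* (`symmCorr_self_nonneg`). If `f(ρ) = ∑ fᵢ eᵢ`, `g(ρ) = ∑ gᵢ eᵢ` and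
`f(ρ) g(ρ) = ∑ fᵢ gᵢ eᵢ` with positive `eᵢ` of sum `1`, the trace property gives
`2 S a a = ∑ᵢⱼ (fᵢ - fⱼ) (gᵢ - gⱼ) E(eᵢ a* eⱼ a)`, where
`E(eᵢ a* eⱼ a) = E(|eⱼ^(1/2) a eᵢ^(1/2)|²)` is positive. The general case is a norm limit of this
one, by partitions of unity of the spectrum (`LinearMap.tracial_cfc_nonneg`). The functional
calculus lives in the unitization, whose spectrum may contain an additional `0`; this point occurs
only if `ρ` is invertible, and then the values of `f` and `g` at `0` are immaterial
(`exists_sameMonotonicOn_quasispectrum`).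

*Cauchy–Schwarz*. The bimodule property and the trace property force the range of `E` to be
commutative (`IsConditionalExpectation.commute`). Hence the values of `S` may be evaluated at
characters of a commutative C*-algebra, and the inequality reduces to the one for scalar positive
semidefinite forms (`CStarAlgebra.star_mul_self_le_mul_of_forall_nonneg`).
-/

open SkewInformation

/-! ### Cauchy–Schwarz inequality for commuting elements of a C*-algebra -/

open scoped ComplexOrder in
/-- If a Hermitian form in two complex variables with coefficients `p`, `s`, `q` is positive
semidefinite, then its determinant is nonnegative. -/
theorem Complex.star_mul_self_le_mul_of_forall_nonneg {p q s : ℂ} (hq : 0 ≤ q)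
    (h : ∀ z : ℂ, 0 ≤ p + z * s + star (z * s) + (z * star z) * q) :
    star s * s ≤ p * q := by
  have hp : 0 ≤ p := by simpa using h 0
  obtain ⟨P, rfl⟩ : ∃ P : ℝ, p = P :=
    ⟨p.re, by apply Complex.ext <;> simp [(nonneg_iff.1 hp).2.symm]⟩
  obtain ⟨Q, rfl⟩ : ∃ Q : ℝ, q = Q :=
    ⟨q.re, by apply Complex.ext <;> simp [(nonneg_iff.1 hq).2.symm]⟩
  -- evaluation at `z = t * star s` gives a quadratic polynomial in the real variable `t`
  have key : ∀ t : ℝ, 0 ≤ (normSq s * Q) * (t * t) + (2 * normSq s) * t + P := by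
    intro t
    have h1 := h (t * star s)
    have h2 : star s * s = (normSq s : ℂ) := by rw [mul_comm]; exact mul_conj s
    have h3 : (P : ℂ) + t * star s * s + star (t * star s * s) + (t * star s * star (t * star s)) * Q
        = (((normSq s * Q) * (t * t) + (2 * normSq s) * t + P : ℝ) : ℂ) := by
      have ht : star (t : ℂ) = t := conj_ofReal t
      simp only [star_mul', star_star, ht]
      push_cast
      rw [← h2]
      ring
    rw [h3] at h1
    exact_mod_cast h1
  have hd := discrim_le_zero key
  have h2 : star s * s = (normSq s : ℂ) := by rw [mul_comm]; exact mul_conj s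
  rw [h2]
  have hn := normSq_nonneg s
  rw [discrim] at hd
  have : normSq s ≤ P * Q := by
    rcases hn.eq_or_lt with h0 | h0
    · have hP : 0 ≤ P := by exact_mod_cast hp
      have hQ : 0 ≤ Q := by exact_mod_cast hq
      rw [← h0]; positivity
    · refine le_of_mul_le_mul_left (a := normSq s) ?_ h0
      linarith
  exact_mod_cast this

open scoped ComplexOrder in
open WeakDual in
/-- Positivity of an element of a commutative C*-subalgebra is detected by characters. -/
theorem StarSubalgebra.coe_nonneg_iff_forall_algHom {U : Type*} [CStarAlgebra U]
    [PartialOrder U] [StarOrderedRing U] (S : StarSubalgebra ℂ U) (hS : IsClosed (S : Set U))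
    (hcomm : ∀ x ∈ S, ∀ y ∈ S, x * y = y * x) (x : S) :
    0 ≤ (x : U) ↔ ∀ φ : S →⋆ₐ[ℂ] ℂ, 0 ≤ φ x := by
  let : NormedCommRing S :=
    { SubringClass.toNormedRing S with
      mul_comm := fun x y => Subtype.ext (hcomm x x.2 y y.2) }
  have : CompleteSpace S := hS.completeSpace_coe
  let : CommCStarAlgebra S := { }
  have hx : IsStarNormal (x : U) := ⟨hcomm _ (star_mem x.2) _ x.2⟩
  rw [StarOrderedRing.nonneg_iff_spectrum_nonneg (R := ℂ) (x : U) hx,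
    ← StarSubalgebra.spectrum_eq S (hS := hS)]
  constructor
  · intro h φ
    exact h _ (AlgHom.apply_mem_spectrum φ x)
  · intro h z hz
    obtain ⟨φ, rfl⟩ := CharacterSpace.mem_spectrum_iff_exists.1 hz
    exact h { CharacterSpace.toAlgHom φ with map_star' := map_star φ }

open scoped ComplexOrder in
/-- Commuting elements of a C*-algebra may be evaluated at the characters of the commutative
C*-algebra that they generate; so the scalar inequality
`Complex.star_mul_self_le_mul_of_forall_nonneg` holds for them. -/
theorem CStarAlgebra.star_mul_self_le_mul_of_forall_nonneg {U : Type*} [CStarAlgebra U]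
    [PartialOrder U] [StarOrderedRing U] {p q s : U} (hpq : Commute p q) (hps : Commute p s)
    (hqs : Commute q s) (hss : Commute s (star s)) (hq : 0 ≤ q)
    (h : ∀ z : ℂ, 0 ≤ p + z • s + star (z • s) + (z * star z) • q) :
    star s * s ≤ p * q := by
  have hp : 0 ≤ p := by simpa using h 0
  have e1 := hp.isSelfAdjoint.star_eq
  have e2 := hq.isSelfAdjoint.star_eq
  have hps' : Commute p (star s) := by simpa [e1] using hps.star_star
  have hqs' : Commute q (star s) := by simpa [e2] using hqs.star_star
  let S : StarSubalgebra ℂ U := (StarAlgebra.adjoin ℂ {p, q, s}).topologicalClosure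
  have hc : IsMulCommutative (StarAlgebra.adjoin ℂ {p, q, s}) := by
    apply StarAlgebra.isMulCommutative_adjoin
    · rintro x (rfl | rfl | rfl) y (rfl | rfl | rfl) <;>
        first | rfl | exact Commute.eq ‹_› | exact (Commute.symm ‹_›).eq
    · rintro x (rfl | rfl | rfl) y (rfl | rfl | rfl) <;> (try simp only [e1, e2]) <;>
        first | exact Commute.eq ‹_› | exact (Commute.symm ‹_›).eq
  have hcomm : ∀ x ∈ S, ∀ y ∈ S, x * y = y * x := fun x hx y hy =>
    congrArg Subtype.val ((StarSubalgebra.commRingTopologicalClosure _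
      (fun x y => mul_comm' x y)).mul_comm ⟨x, hx⟩ ⟨y, hy⟩)
  have hS : IsClosed (S : Set U) := StarSubalgebra.isClosed_topologicalClosure _
  have key := S.coe_nonneg_iff_forall_algHom hS hcomm
  have hmem : ∀ x ∈ ({p, q, s} : Set U), x ∈ S := fun x hx =>
    StarSubalgebra.le_topologicalClosure _ (StarAlgebra.subset_adjoin ℂ _ hx)
  let p' : S := ⟨p, hmem p (by simp)⟩
  let q' : S := ⟨q, hmem q (by simp)⟩
  let s' : S := ⟨s, hmem s (by simp)⟩
  rw [← sub_nonneg]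
  refine (key (p' * q' - star s' * s')).2 fun φ => ?_
  rw [map_sub, map_mul, map_mul, map_star, sub_nonneg]
  refine Complex.star_mul_self_le_mul_of_forall_nonneg ((key q').1 hq φ) fun z => ?_
  have := (key (p' + z • s' + star (z • s') + (z * star z) • q')).1 (h z) φ
  simpa only [map_add, map_smul, map_star, smul_eq_mul] using this

/-! ### Positivity of the symmetrized quadratic form of a tracial positive map -/

/-- With `∑ fᵢ gᵢ eᵢ` in place of the product of `∑ fᵢ eᵢ` and `∑ gᵢ eᵢ`, where `∑ eᵢ = 1`, the trace
property makes the symmetrized form a double sum with weights `(fᵢ - fⱼ) (gᵢ - gⱼ)`. -/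
theorem LinearMap.tracial_sum_eq {U C ι : Type*} [Ring U] [Algebra ℝ U] [AddCommGroup C]
    [Module ℝ C] (T : U →ₗ[ℝ] C) (hT : ∀ u v, T (u * v) = T (v * u)) (t : Finset ι)
    (e : ι → U) (he : ∑ i ∈ t, e i = 1) (f g : ι → ℝ) (a c : U) :
    T ((∑ i ∈ t, (f i * g i) • e i) * (c * a + a * c)) -
      T ((∑ i ∈ t, f i • e i) * c * (∑ j ∈ t, g j • e j) * a) -
      T ((∑ i ∈ t, f i • e i) * a * (∑ j ∈ t, g j • e j) * c) =
    ∑ i ∈ t, ∑ j ∈ t, ((f i - f j) * (g i - g j)) • T (e i * c * e j * a) := by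
  have expand (x y : ι → ℝ) (b d : U) :
      T ((∑ i ∈ t, x i • e i) * b * (∑ j ∈ t, y j • e j) * d) =
        ∑ i ∈ t, ∑ j ∈ t, (x i * y j) • T (e i * b * e j * d) := by
    simp only [Finset.sum_mul, Finset.mul_sum, map_sum]
    rw [Finset.sum_comm]
    refine Finset.sum_congr rfl fun i _ => Finset.sum_congr rfl fun j _ => ?_
    simp only [smul_mul_assoc, mul_smul_comm, map_smul, smul_smul, mul_comm]
  have expand' (x y : ι → ℝ) :
      T ((∑ i ∈ t, x i • e i) * a * (∑ j ∈ t, y j • e j) * c) =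
        ∑ i ∈ t, ∑ j ∈ t, (x j * y i) • T (e i * c * e j * a) := by
    rw [expand, Finset.sum_comm]
    refine Finset.sum_congr rfl fun i _ => Finset.sum_congr rfl fun j _ => ?_
    rw [mul_assoc _ _ c, hT, ← mul_assoc]
  have h1 (x : ι → ℝ) := expand x (fun _ => 1) c a
  have h2 (x : ι → ℝ) := expand' x (fun _ => 1)
  simp only [one_smul, he, mul_one] at h1 h2
  rw [mul_add, map_add, ← mul_assoc, ← mul_assoc, h1, h2, expand, expand']
  simp only [← Finset.sum_add_distrib, ← Finset.sum_sub_distrib, ← add_smul, ← sub_smul]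
  refine Finset.sum_congr rfl fun i _ => Finset.sum_congr rfl fun j _ => ?_
  congr 1
  ring

/-- The functions `φ ∘ F` on a compact set, for all 1-Lipschitz `φ` at once, are uniformly
approximated by interpolating their values at finitely many points with a common partition of unity.
If `Y` is a product, the coordinates are possible choices of `φ`. -/
theorem IsCompact.exists_partition_approx {X Y : Type*} [TopologicalSpace X] [PseudoMetricSpace Y]
    {K : Set X} (hK : IsCompact K) {F : X → Y} (hF : ContinuousOn F K) {ε : ℝ} (hε : 0 < ε) :
    ∃ (t : Finset X) (χ : X → X → ℝ), (∀ i ∈ t, i ∈ K) ∧ (∀ i ∈ t, ContinuousOn (χ i) K) ∧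
      (∀ i ∈ t, ∀ x ∈ K, 0 ≤ χ i x) ∧ (∀ x ∈ K, ∑ i ∈ t, χ i x = 1) ∧
      ∀ φ : Y → ℝ, LipschitzWith 1 φ →
        ∀ x ∈ K, |φ (F x) - ∑ i ∈ t, φ (F i) * χ i x| ≤ ε := by
  obtain ⟨t, htK, ht⟩ := hK.elim_nhdsWithin_subcover (fun x => {y | dist (F y) (F x) < ε})
    (fun x hx => Metric.tendsto_nhds.1 (hF x hx) ε hε)
  let ψ : X → X → ℝ := fun i x => max 0 (ε - dist (F x) (F i))
  have hψc (i : X) : ContinuousOn (ψ i) K :=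
    continuousOn_const.sup (continuousOn_const.sub
      (continuous_dist.comp_continuousOn (hF.prodMk continuousOn_const)))
  have hψ0 (i x : X) : 0 ≤ ψ i x := le_max_left _ _
  have hpos : ∀ x ∈ K, 0 < ∑ i ∈ t, ψ i x := by
    intro x hx
    obtain ⟨i, hi, hxi⟩ := Set.mem_iUnion₂.1 (ht hx)
    exact Finset.sum_pos' (fun i _ => hψ0 i x) ⟨i, hi, lt_max_of_lt_right (sub_pos.2 hxi)⟩
  have hsum : ∀ x ∈ K, ∑ i ∈ t, ψ i x / ∑ j ∈ t, ψ j x = 1 := fun x hx => by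
    rw [← Finset.sum_div, div_self (hpos x hx).ne']
  refine ⟨t, fun i x => ψ i x / ∑ j ∈ t, ψ j x, htK, fun i _ => (hψc i).div
    (continuousOn_finsetSum _ fun j _ => hψc j) fun x hx => (hpos x hx).ne',
    fun i _ x hx => div_nonneg (hψ0 i x) (hpos x hx).le, hsum, fun φ hφ x hx => ?_⟩
  have h1 : φ (F x) - ∑ i ∈ t, φ (F i) * (ψ i x / ∑ j ∈ t, ψ j x) =
      ∑ i ∈ t, (φ (F x) - φ (F i)) * (ψ i x / ∑ j ∈ t, ψ j x) := by
    simp only [sub_mul, Finset.sum_sub_distrib]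
    rw [← Finset.mul_sum, hsum x hx, mul_one]
  rw [h1]
  refine (Finset.abs_sum_le_sum_abs _ _).trans ?_
  calc _ ≤ ∑ i ∈ t, ε * (ψ i x / ∑ j ∈ t, ψ j x) := Finset.sum_le_sum fun i _ => ?_
    _ = ε := by rw [← Finset.mul_sum, hsum x hx, mul_one]
  rw [abs_mul, abs_of_nonneg (div_nonneg (hψ0 i x) (hpos x hx).le)]
  by_cases hd : dist (F x) (F i) < ε
  · refine mul_le_mul_of_nonneg_right ?_ (div_nonneg (hψ0 i x) (hpos x hx).le)
    have := hφ.dist_le_mul (F x) (F i)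
    rw [Real.dist_eq] at this
    simp only [NNReal.coe_one, one_mul] at this
    exact this.trans hd.le
  · -- the `i`-th weight vanishes at `x`
    have : ψ i x = 0 := max_eq_left (sub_nonpos.2 (not_lt.1 hd))
    simp [this]

/-- If `f` and `g` are same monotonic on the spectrum of `R`, then the quadratic form of the
symmetrized correlation is nonnegative, for a tracial map `T` that is positive at the elements
`|u a v|²`. By a partition of unity of the spectrum it is a limit of sums
`∑ᵢⱼ (fᵢ - fⱼ) (gᵢ - gⱼ) T(|eⱼ^(1/2) a eᵢ^(1/2)|²)`. -/
theorem LinearMap.tracial_cfc_nonneg {U C : Type*} [CStarAlgebra U] [NonUnitalCStarAlgebra C]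
    [PartialOrder C] [StarOrderedRing C] (T : U →ₗ[ℝ] C) (hTc : Continuous T)
    (hT : ∀ u v, T (u * v) = T (v * u)) {R : U} (hR : IsSelfAdjoint R) {f g : ℝ → ℝ}
    (hf : ContinuousOn f (spectrum ℝ R)) (hg : ContinuousOn g (spectrum ℝ R))
    (hfg : SameMonotonicOn f g (spectrum ℝ R)) (a : U)
    (hpos : ∀ u v : U, 0 ≤ T (star (u * a * v) * (u * a * v))) :
    0 ≤ T (cfc f R * cfc g R * (star a * a + a * star a)) -
      T (cfc f R * star a * cfc g R * a) - T (cfc f R * a * cfc g R * star a) := by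
  rw [← cfc_mul f g R hf hg]
  let Ψ : U × U × U → C := fun w => T (w.1 * (star a * a + a * star a)) -
      T (w.2.1 * star a * w.2.2 * a) - T (w.2.1 * a * w.2.2 * star a)
  have hΨ : Continuous Ψ := by fun_prop
  have hcl : IsClosed {w | 0 ≤ Ψ w} := CStarAlgebra.isClosed_nonneg.preimage hΨ
  change (cfc (fun x => f x * g x) R, cfc f R, cfc g R) ∈ {w | 0 ≤ Ψ w}
  rw [← hcl.closure_eq, Metric.mem_closure_iff]
  intro ε hε
  -- `f * g` is interpolated along with `f` and `g`: the product of the interpolations of `f` and `g`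
  -- is not of the form `∑ fᵢ gᵢ χᵢ`
  obtain ⟨t, χ, htK, hχc, hχ0, hχ1, happ⟩ := (ContinuousFunctionalCalculus.isCompact_spectrum
    (R := ℝ) R).exists_partition_approx
    (F := fun x => (f x * g x, f x, g x)) ((hf.mul hg).prodMk (hf.prodMk hg)) (half_pos hε)
  have hsum (y : ℝ → ℝ) : ∑ i ∈ t, y i • cfc (χ i) R = cfc (fun x => ∑ i ∈ t, y i * χ i x) R := by
    have := cfc_sum (fun i x => y i * χ i x) R t fun i hi => continuousOn_const.mul (hχc i hi)
    rw [show (fun x => ∑ i ∈ t, y i * χ i x) = ∑ i ∈ t, fun x => y i * χ i x by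
      ext x; simp, this]
    exact Finset.sum_congr rfl fun i hi => (cfc_smul _ _ R (hχc i hi)).symm
  have hcfc (φ : ℝ × ℝ × ℝ → ℝ) (hφ : LipschitzWith 1 φ)
      (hφc : ContinuousOn (fun x => φ (f x * g x, f x, g x)) (spectrum ℝ R)) :
      dist (cfc (fun x => φ (f x * g x, f x, g x)) R)
        (∑ i ∈ t, φ (f i * g i, f i, g i) • cfc (χ i) R) < ε := by
    have hc : ContinuousOn (fun x => ∑ i ∈ t, φ (f i * g i, f i, g i) * χ i x) (spectrum ℝ R) :=
      continuousOn_finsetSum _ fun i hi => continuousOn_const.mul (hχc i hi)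
    rw [hsum, dist_eq_norm, ← cfc_sub _ _ R hφc hc]
    exact (norm_cfc_le (half_pos hε).le fun x hx => happ φ hφ x hx).trans_lt (half_lt_self hε)
  refine ⟨(∑ i ∈ t, (f i * g i) • cfc (χ i) R, ∑ i ∈ t, f i • cfc (χ i) R,
    ∑ i ∈ t, g i • cfc (χ i) R), ?_, ?_⟩
  · have he : ∑ i ∈ t, cfc (χ i) R = 1 := by
      have := hsum fun _ => 1
      simp only [one_smul, one_mul] at this
      rw [this, cfc_congr (g := fun _ => 1) hχ1, cfc_const_one ℝ R]
    change 0 ≤ _ - _ - _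
    rw [T.tracial_sum_eq hT t (fun i => cfc (χ i) R) he f g a (star a)]
    refine Finset.sum_nonneg fun i hi => Finset.sum_nonneg fun j hj =>
      smul_nonneg (hfg i (htK i hi) j (htK j hj)) ?_
    have hsqrt (k : ℝ) (hk : k ∈ t) :
        cfc (χ k) R = cfc (fun x => √(χ k x)) R * cfc (fun x => √(χ k x)) R := by
      rw [← cfc_mul _ _ R (hχc k hk).sqrt (hχc k hk).sqrt]
      exact cfc_congr fun x hx => (Real.mul_self_sqrt (hχ0 k hk x hx)).symm
    have hsa (k : ℝ) : star (cfc (fun x => √(χ k x)) R) = cfc (fun x => √(χ k x)) R :=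
      (cfc_predicate (p := IsSelfAdjoint) _ R).star_eq
    have := hpos (cfc (fun x => √(χ j x)) R) (cfc (fun x => √(χ i x)) R)
    rw [star_mul, star_mul, hsa, hsa] at this
    rw [hsqrt i hi, hsqrt j hj]
    convert this using 1
    rw [mul_assoc (cfc (fun x => √(χ i x)) R), mul_assoc (cfc (fun x => √(χ i x)) R),
      mul_assoc (cfc (fun x => √(χ i x)) R), hT]
    noncomm_ring
  · refine max_lt ?_ (max_lt ?_ ?_)
    · exact hcfc Prod.fst LipschitzWith.prod_fst (hf.mul hg)
    · exact hcfc (fun w => w.2.1)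
        (by simpa using! LipschitzWith.prod_fst.comp LipschitzWith.prod_snd) hf
    · exact hcfc (fun w => w.2.2)
        (by simpa using! LipschitzWith.prod_snd.comp LipschitzWith.prod_snd) hg

namespace SkewInformation

/-! ### Tracial conditional expectations -/

section ConditionalExpectation

variable {A : Type*} [NonUnitalCStarAlgebra A]

theorem IsConditionalExpectation.continuous [PartialOrder A]
    {B : NonUnitalStarSubalgebra ℂ A} {E : A →ₗ[ℂ] A} (hE : IsConditionalExpectation B E) :
    Continuous E :=
  (E.mkContinuous 1 fun a => by simpa using hE.contractive a).continuous

theorem IsConditionalExpectation.map_star [PartialOrder A] [StarOrderedRing A]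
    {B : NonUnitalStarSubalgebra ℂ A} {E : A →ₗ[ℂ] A} (hE : IsConditionalExpectation B E) (a : A) :
    E (star a) = star (E a) :=
  StarHomClass.map_star (PositiveLinearMap.mk₀ E hE.positive) a

/-- The range of a tracial conditional expectation is commutative. No approximate unit of `B` is
used: the bimodule property shows that `c * E a * d` is central in `B` for `c`, `d` in `B`, hence the
commutator `w` of two elements of the range satisfies `w * star w * w = 0`. -/
theorem IsConditionalExpectation.commute [PartialOrder A] {B : NonUnitalStarSubalgebra ℂ A}
    {E : A →ₗ[ℂ] A} (hE : IsConditionalExpectation B E) (hE' : IsTracial E) (a₁ a₂ : A) :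
    Commute (E a₁) (E a₂) := by
  -- both sides are `E (b * c * a * d)`, by the trace property
  have central (a b c d : A) (hb : b ∈ B) (hc : c ∈ B) (hd : d ∈ B) :
      b * (c * E a * d) = c * E a * d * b := by
    have h1 := hE.bimodule a (b * c) (mul_mem hb hc) d hd
    have h2 := hE.bimodule a c hc (d * b) (mul_mem hd hb)
    have h3 := hE' b (c * a * d)
    simp only [← mul_assoc] at h1 h2 h3 ⊢
    rw [← h1, h3, h2]
  -- `b * (b' * z) = b' * z * b = b' * (b * z)` for `z = c * E a * d`, as `b' * z` has the same form
  have annihilate (a b b' c d : A) (hb : b ∈ B) (hb' : b' ∈ B) (hc : c ∈ B) (hd : d ∈ B) :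
      (b * b' - b' * b) * (c * E a * d) = 0 := by
    have h1 := central a b c d hb hc hd
    have h2 := central a b (b' * c) d hb (mul_mem hb' hc) hd
    have h3 : b * b' * (c * E a * d) = b * (b' * c * E a * d) := by noncomm_ring
    have h4 : b' * b * (c * E a * d) = b' * (b * (c * E a * d)) := by noncomm_ring
    rw [sub_mul, h3, h2, h4, h1]
    noncomm_ring
  have hx := hE.mem_range a₁
  have hy := hE.mem_range a₂
  set x := E a₁ with hxdef
  set y := E a₂ with hydef
  set w := x * y - y * x with hw
  have hwB : star w ∈ B := star_mem (sub_mem (mul_mem hx hy) (mul_mem hy hx))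
  have h0 : w * star w * w = 0 := by
    have h1 := annihilate a₁ x y (star w) y hx hy hwB hy
    have h2 := annihilate a₂ x y (star w) x hx hy hwB hx
    rw [← hxdef, ← hw] at h1
    rw [← hydef, ← hw] at h2
    calc w * star w * w = w * (star w * x * y) - w * (star w * y * x) := by
          nth_rw 3 [hw]; noncomm_ring
      _ = 0 := by rw [h1, h2, sub_zero]
  have h1 : star (w * star w) * (w * star w) = 0 := by
    rw [star_mul, star_star, ← mul_assoc, h0, zero_mul]
  exact sub_eq_zero.1 (CStarRing.mul_star_self_eq_zero_iff w |>.1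
    ((CStarRing.star_mul_self_eq_zero_iff _).1 h1))

/-- The extension of `E` to the unitization by `0` at the unit. It is again tracial. -/
def unitizationExt (E : A →ₗ[ℂ] A) : Unitization ℂ A →ₗ[ℂ] A :=
  E ∘ₗ Unitization.sndHom ℂ ℂ A

@[simp]
theorem unitizationExt_inr (E : A →ₗ[ℂ] A) (a : A) :
    unitizationExt E (Unitization.inr a) = E a := rfl

theorem IsTracial.unitizationExt {E : A →ₗ[ℂ] A} (hE' : IsTracial E) (u v : Unitization ℂ A) :
    unitizationExt E (u * v) = unitizationExt E (v * u) := by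
  simp only [SkewInformation.unitizationExt, LinearMap.comp_apply, Unitization.sndHom_apply,
    Unitization.snd_mul, map_add, hE' u.snd v.snd]
  abel

theorem IsConditionalExpectation.unitizationExt_star [PartialOrder A] [StarOrderedRing A]
    {B : NonUnitalStarSubalgebra ℂ A} {E : A →ₗ[ℂ] A} (hE : IsConditionalExpectation B E)
    (u : Unitization ℂ A) : unitizationExt E (star u) = star (unitizationExt E u) := by
  simp [unitizationExt, hE.map_star]

/-- The correlation as an expression in the unitization, where `f(ρ)` and `g(ρ)` live. -/
theorem corr_eq (E : A →ₗ[ℂ] A) (f g : ℝ → ℝ) (ρ a b : A) :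
    corr E f g ρ a b =
      unitizationExt E (cfc f (ρ : Unitization ℂ A) * cfc g (ρ : Unitization ℂ A) *
        (star (a : Unitization ℂ A) * b)) -
      unitizationExt E (cfc f (ρ : Unitization ℂ A) * star (a : Unitization ℂ A) *
        cfc g (ρ : Unitization ℂ A) * b) := by
  rw [corr, ← unitizationExt_inr, ← unitizationExt_inr E (_ * _)]
  simp only [inr_cfcMul, Unitization.inr_mul, Unitization.inr_star, mul_assoc]

theorem symmCorr_eq (E : A →ₗ[ℂ] A) (f g : ℝ → ℝ) (ρ a b : A) :
    symmCorr E f g ρ a b = (1 / 2 : ℂ) •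
      (unitizationExt E (cfc f (ρ : Unitization ℂ A) * cfc g (ρ : Unitization ℂ A) *
        (star (a : Unitization ℂ A) * b + b * star (a : Unitization ℂ A))) -
      unitizationExt E (cfc f (ρ : Unitization ℂ A) * star (a : Unitization ℂ A) *
        cfc g (ρ : Unitization ℂ A) * b) -
      unitizationExt E (cfc f (ρ : Unitization ℂ A) * b *
        cfc g (ρ : Unitization ℂ A) * star (a : Unitization ℂ A))) := by
  rw [symmCorr, corr_eq, corr_eq, mul_add, map_add]
  simp only [Unitization.inr_star, star_star]
  module

end ConditionalExpectation

/-! ### The spectrum and the quasispectrum -/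

section Spectrum

variable {A : Type*} [NonUnitalCStarAlgebra A]

/-- If `a` is invertible, then `opSpectrum a` is the spectrum in the unital algebra `A`, so that `0`
is an isolated point of the quasispectrum. -/
theorem isClosed_opSpectrum (a : A) : IsClosed (opSpectrum a) := by
  by_cases ha : IsInvertibleIn a
  · obtain ⟨e, b, he, h1, h2⟩ := id ha
    -- the unit `e` turns `A` into a unital C*-algebra
    let : Ring A :=
      { ‹NonUnitalCStarAlgebra A› with
        one := e
        one_mul := fun x => (he x).1
        mul_one := fun x => (he x).2 }
    let alg : Algebra ℂ A := Algebra.ofModule smul_mul_assoc mul_smul_comm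
    let : CStarAlgebra A :=
      { ‹NonUnitalCStarAlgebra A›, (inferInstance : Ring A), alg with }
    rw [opSpectrum_eq_spectrum]
    exact spectrum.isClosed a
  · have : opSpectrum a = quasispectrum ℝ a := by
      ext x; simp [opSpectrum, ha]
    rw [this]
    exact (NonUnitalContinuousFunctionalCalculus.isCompact_quasispectrum a).isClosed

theorem insert_zero_opSpectrum (a : A) : insert 0 (opSpectrum a) = quasispectrum ℝ a := by
  ext x
  by_cases hx : x = 0
  · simp [hx, quasispectrum.zero_mem]
  · simp [opSpectrum, hx]

/-- Functions that are same monotonic on `opSpectrum ρ` can be replaced by functions that are same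
monotonic on the whole quasispectrum, without changing the products `f(ρ) a`. -/
theorem exists_sameMonotonicOn_quasispectrum {ρ : A} (hρ : IsSelfAdjoint ρ) {f g : ℝ → ℝ}
    (hf : ContinuousOn f (opSpectrum ρ)) (hg : ContinuousOn g (opSpectrum ρ))
    (hfg : SameMonotonicOn f g (opSpectrum ρ)) :
    ∃ f' g' : ℝ → ℝ, ContinuousOn f' (quasispectrum ℝ ρ) ∧ ContinuousOn g' (quasispectrum ℝ ρ) ∧
      SameMonotonicOn f' g' (quasispectrum ℝ ρ) ∧
      (∀ a, cfcMul f' ρ a = cfcMul f ρ a) ∧ ∀ a, cfcMul g' ρ a = cfcMul g ρ a := by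
  have hins := insert_zero_opSpectrum ρ
  have hcl := isClosed_opSpectrum ρ
  have hext {k : ℝ → ℝ} (hk : ContinuousOn k (opSpectrum ρ)) (h0 : (0 : ℝ) ∉ opSpectrum ρ) (c : ℝ) :
      ContinuousOn (Function.update k 0 c) (quasispectrum ℝ ρ) := by
    rw [← hins, ← Set.singleton_union]
    refine (continuousOn_singleton _ 0).union_of_isClosed (hk.congr fun x hx => ?_)
      isClosed_singleton hcl
    exact Function.update_of_ne (by rintro rfl; exact h0 hx) _ _
  by_cases h0 : (0 : ℝ) ∈ opSpectrum ρ
  · rw [Set.insert_eq_of_mem h0] at hins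
    rw [← hins]
    exact ⟨f, g, hf, hg, hfg, fun _ => rfl, fun _ => rfl⟩
  · have hinv : IsInvertibleIn ρ := by
      by_contra h
      exact h0 ⟨quasispectrum.zero_mem ℝ ρ, fun _ => h⟩
    -- `f(ρ) a = f(ρ) ρ (ρ⁻¹ a)`, and `x ↦ f(x) x` does not depend on `f(0)`
    have hmul {k : ℝ → ℝ} (hk : ContinuousOn k (opSpectrum ρ)) (c : ℝ) (a : A) :
        cfcMul (Function.update k 0 c) ρ a = cfcMul k ρ a := by
      obtain ⟨e, b, he, hb, -⟩ := hinv
      have ha : a = ρ * (b * a) := by rw [← mul_assoc, hb, (he a).1]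
      have hR : IsSelfAdjoint (ρ : Unitization ℂ A) := hρ.inr ℂ
      have hk0 := hext hk h0 (k 0)
      rw [Function.update_eq_self, Unitization.quasispectrum_eq_spectrum_inr' ℝ ℂ] at hk0
      have hkc := hext hk h0 c
      rw [Unitization.quasispectrum_eq_spectrum_inr' ℝ ℂ] at hkc
      have key (l : ℝ → ℝ) (hl : ContinuousOn l (spectrum ℝ (ρ : Unitization ℂ A))) :
          cfc l (ρ : Unitization ℂ A) * ρ = cfc (fun x => l x * x) (ρ : Unitization ℂ A) := by
        rw [cfc_mul l (fun x => x) _ hl continuousOn_id, cfc_id' ℝ (ρ : Unitization ℂ A)]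
      have heq : (fun x => Function.update k 0 c x * x) = fun x => k x * x := by
        ext x
        by_cases hx : x = 0 <;> simp [hx]
      rw [cfcMul, cfcMul, ha, Unitization.inr_mul, ← mul_assoc, ← mul_assoc, key _ hkc, key _ hk0,
        heq]
    rcases (opSpectrum ρ).eq_empty_or_nonempty with hemp | ⟨x₀, hx₀⟩
    · refine ⟨Function.update f 0 0, Function.update g 0 0, hext hf h0 0, hext hg h0 0, ?_,
        hmul hf 0, hmul hg 0⟩
      rw [← hins, hemp]
      rintro x (rfl | hx) y (rfl | hy) <;> simp_all
    -- the value at `0` is copied from another point, which preserves same monotonicity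
    · refine ⟨Function.update f 0 (f x₀), Function.update g 0 (g x₀), hext hf h0 _, hext hg h0 _,
        ?_, hmul hf _, hmul hg _⟩
      have hval : ∀ x ∈ quasispectrum ℝ ρ, ∃ x' ∈ opSpectrum ρ,
          Function.update f 0 (f x₀) x = f x' ∧ Function.update g 0 (g x₀) x = g x' := by
        rw [← hins]
        rintro x (rfl | hx)
        · exact ⟨x₀, hx₀, by simp⟩
        · have hx0 : x ≠ 0 := by rintro rfl; exact h0 hx
          exact ⟨x, hx, by simp [hx0]⟩
      intro x hx y hy
      obtain ⟨x', hx', h1, h2⟩ := hval x hx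
      obtain ⟨y', hy', h3, h4⟩ := hval y hy
      rw [h1, h2, h3, h4]
      exact hfg x' hx' y' hy'

end Spectrum

/-! ### The symmetrized correlation as a positive semidefinite form -/

section Correlation

open scoped CStarAlgebra

variable {A : Type*} [NonUnitalCStarAlgebra A]

theorem symmCorr_add_smul_self (E : A →ₗ[ℂ] A) (f g : ℝ → ℝ) (ρ a b : A) (z : ℂ) :
    symmCorr E f g ρ (a + z • b) (a + z • b) = symmCorr E f g ρ a a + z • symmCorr E f g ρ a b +
      star z • symmCorr E f g ρ b a + (z * star z) • symmCorr E f g ρ b b := by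
  simp only [symmCorr_eq, Unitization.inr_add, Unitization.inr_smul, star_add, star_smul, mul_add,
    add_mul, smul_mul_assoc, mul_smul_comm, map_add, map_smul]
  module

theorem symmCorr_self_of_corr_star (Φ : A →ₗ[ℂ] A) (f g : ℝ → ℝ) (ρ : A) {a : A}
    (h : corr Φ f g ρ (star a) (star a) = corr Φ f g ρ a a) :
    symmCorr Φ f g ρ a a = skewInfo Φ f g ρ a := by
  rw [symmCorr, h, skewInfo]
  module

theorem symmCorr_self_of_isSelfAdjoint (E : A →ₗ[ℂ] A) (f g : ℝ → ℝ) (ρ : A) {a : A}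
    (ha : IsSelfAdjoint a) : symmCorr E f g ρ a a = skewInfo E f g ρ a :=
  symmCorr_self_of_corr_star E f g ρ (by rw [ha.star_eq])

/-- For `f = g` the trace property turns `f(ρ) a f(ρ) a*` into `f(ρ) a* f(ρ) a`, so normality of
`a` is enough for the symmetrization to have no effect on the diagonal. -/
theorem symmCorr_self_of_isStarNormal {E : A →ₗ[ℂ] A} (hE' : IsTracial E) (f : ℝ → ℝ) (ρ : A)
    {a : A} (ha : IsStarNormal a) : symmCorr E f f ρ a a = skewInfo E f f ρ a := by
  refine symmCorr_self_of_corr_star E f f ρ ?_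
  have hn : (a : Unitization ℂ A) * star (a : Unitization ℂ A) = star (a : Unitization ℂ A) * a :=
    (Unitization.isStarNormal_inr.2 ha).star_comm_self.eq.symm
  rw [corr_eq, corr_eq, Unitization.inr_star, star_star, hn, mul_assoc _ _ (star _),
    hE'.unitizationExt (_ * _) (_ * star _)]
  simp only [mul_assoc]

variable [PartialOrder A] [StarOrderedRing A] {B : NonUnitalStarSubalgebra ℂ A} {E : A →ₗ[ℂ] A}

/-- The symmetrized correlation of same monotonic functions is positive semidefinite on all of
`A`, not only on self-adjoint elements. -/
theorem symmCorr_self_nonneg (hE : IsConditionalExpectation B E) (hE' : IsTracial E) {ρ : A}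
    (hρ : IsSelfAdjoint ρ) {f g : ℝ → ℝ} (hf : ContinuousOn f (opSpectrum ρ))
    (hg : ContinuousOn g (opSpectrum ρ)) (hfg : SameMonotonicOn f g (opSpectrum ρ)) (a : A) :
    0 ≤ symmCorr E f g ρ a a := by
  obtain ⟨f', g', hf', hg', hfg', h1, h2⟩ := exists_sameMonotonicOn_quasispectrum hρ hf hg hfg
  have : symmCorr E f g ρ a a = symmCorr E f' g' ρ a a := by simp only [symmCorr, corr, h1, h2]
  rw [this, symmCorr_eq]
  rw [Unitization.quasispectrum_eq_spectrum_inr' ℝ ℂ] at hf' hg' hfg'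
  have hhalf : (1 / 2 : ℂ) = ((1 / 2 : ℝ) : ℂ) := by norm_num
  rw [hhalf, Complex.coe_smul]
  refine smul_nonneg (by norm_num) (LinearMap.tracial_cfc_nonneg
    ((unitizationExt E).restrictScalars ℝ) ?_ hE'.unitizationExt (hρ.inr ℂ) hf' hg' hfg' _ ?_)
  · exact hE.continuous.comp (Unitization.continuous_snd (𝕜 := ℂ) (A := A))
  · intro u v
    obtain ⟨c, hc⟩ : ∃ c : A, u * (a : Unitization ℂ A) * v = Unitization.inr c :=
      ⟨(u * (a : Unitization ℂ A) * v).snd, by ext <;> simp⟩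
    rw [hc, ← Unitization.inr_star, ← Unitization.inr_mul]
    exact hE.positive _ (star_mul_self_nonneg c)

theorem star_corr (hE : IsConditionalExpectation B E) (hE' : IsTracial E) (f g : ℝ → ℝ)
    (ρ a b : A) : star (corr E f g ρ a b) = corr E f g ρ b a := by
  have hF (k : ℝ → ℝ) : star (cfc k (ρ : Unitization ℂ A)) = cfc k (ρ : Unitization ℂ A) :=
    (cfc_predicate (p := IsSelfAdjoint) k _).star_eq
  have hFG := (cfc_commute_cfc f g (ρ : Unitization ℂ A)).eq
  have hcycle (x y z w : Unitization ℂ A) :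
      unitizationExt E (x * (y * (z * w))) = unitizationExt E (w * x * y * z) := by
    simpa only [mul_assoc] using hE'.unitizationExt (x * y * z) w
  rw [corr_eq, corr_eq]
  simp only [star_sub, ← hE.unitizationExt_star, star_mul, star_star, hF]
  rw [hE'.unitizationExt (_ * _) (_ * _), ← hFG, hcycle]

theorem star_symmCorr (hE : IsConditionalExpectation B E) (hE' : IsTracial E) (f g : ℝ → ℝ)
    (ρ a b : A) : star (symmCorr E f g ρ a b) = symmCorr E f g ρ b a := by
  simp [symmCorr, star_corr hE hE']

/-- Cauchy–Schwarz inequality for the symmetrized correlation. -/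
theorem absSq_symmCorr_le (hE : IsConditionalExpectation B E) (hE' : IsTracial E) {ρ : A}
    (hρ : IsSelfAdjoint ρ) {f g : ℝ → ℝ} (hf : ContinuousOn f (opSpectrum ρ))
    (hg : ContinuousOn g (opSpectrum ρ)) (hfg : SameMonotonicOn f g (opSpectrum ρ)) (a b : A) :
    absSq (symmCorr E f g ρ a b) ≤ symmCorr E f g ρ a a * symmCorr E f g ρ b b := by
  have hpos := symmCorr_self_nonneg hE hE' hρ hf hg hfg
  have hcomm (a b c d : A) : Commute (symmCorr E f g ρ a b) (symmCorr E f g ρ c d) := by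
    rw [symmCorr, symmCorr, corr, corr, corr, corr]
    simp only [← map_sub, ← map_add, ← map_smul]
    exact hE.commute hE' _ _
  have hinr {x y : A} (h : Commute x y) : Commute (x : Unitization ℂ A) y :=
    h.map (Unitization.inrNonUnitalAlgHom ℂ A)
  have hstar := star_symmCorr hE hE' f g ρ a b
  rw [absSq, CFC.abs_mul_abs, ← sub_nonneg, ← Unitization.inr_nonneg_iff, Unitization.inr_sub,
    sub_nonneg, Unitization.inr_mul, Unitization.inr_mul, Unitization.inr_star]
  refine CStarAlgebra.star_mul_self_le_mul_of_forall_nonneg (hinr (hcomm _ _ _ _))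
    (hinr (hcomm _ _ _ _)) (hinr (hcomm _ _ _ _)) ?_ (Unitization.inr_nonneg_iff.2 (hpos b))
    fun z => ?_
  · rw [← Unitization.inr_star, hstar]
    exact hinr (hcomm _ _ _ _)
  · have := Unitization.inr_nonneg_iff.2 (hpos (a + z • b))
    rw [symmCorr_add_smul_self, ← hstar] at this
    simpa only [Unitization.inr_add, Unitization.inr_smul, Unitization.inr_star, star_smul]
      using this

/-- On self-adjoint elements the symmetrized correlation is the real part of the correlation. -/
theorem symmCorr_eq_realPart (hE : IsConditionalExpectation B E) (hE' : IsTracial E)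
    (f g : ℝ → ℝ) (ρ : A) {a b : A} (ha : IsSelfAdjoint a) (hb : IsSelfAdjoint b) :
    symmCorr E f g ρ a b = (ℜ (corr E f g ρ a b) : A) := by
  rw [realPart_apply_coe, star_corr hE hE', symmCorr, ha.star_eq, hb.star_eq, ← Complex.coe_smul]
  norm_num

end Correlation

end SkewInformation

theorem mainTheorem7 {A : Type*} [NonUnitalCStarAlgebra A] [PartialOrder A] [StarOrderedRing A]
    (B : NonUnitalStarSubalgebra ℂ A) (hB : IsClosed (B : Set A))
    (E : A →ₗ[ℂ] A) (hE : IsConditionalExpectation B E) (hE' : IsTracial E)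
    (ρ : A) (hρ : 0 ≤ ρ) :
    (∀ f g : ℝ → ℝ, ContinuousOn f (opSpectrum ρ) → ContinuousOn g (opSpectrum ρ) →
      SameMonotonicOn f g (opSpectrum ρ) →
      ∀ a b : A, IsSelfAdjoint a → IsSelfAdjoint b →
        absSq (symmCorr E f g ρ a b) = absSq (ℜ (corr E f g ρ a b) : A) ∧
        absSq (ℜ (corr E f g ρ a b) : A) ≤ skewInfo E f g ρ a * skewInfo E f g ρ b) ∧
    (∀ f : ℝ → ℝ, ContinuousOn f (opSpectrum ρ) →
      ∀ a b : A, IsStarNormal a → IsStarNormal b →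
        absSq (symmCorr E f f ρ a b) ≤ skewInfo E f f ρ a * skewInfo E f f ρ b) := by
  have hρ' := hρ.isSelfAdjoint
  constructor
  · intro f g hf hg hfg a b ha hb
    rw [← symmCorr_eq_realPart hE hE' f g ρ ha hb,
      ← symmCorr_self_of_isSelfAdjoint E f g ρ ha, ← symmCorr_self_of_isSelfAdjoint E f g ρ hb]
    exact ⟨rfl, absSq_symmCorr_le hE hE' hρ' hf hg hfg a b⟩
  · intro f hf a b ha hb
    rw [← symmCorr_self_of_isStarNormal hE' f ρ ha, ← symmCorr_self_of_isStarNormal hE' f ρ hb]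
    exact absSq_symmCorr_le hE hE' hρ' hf hf (fun x _ y _ => mul_self_nonneg _) a b
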